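/- Identify the Euclidean plane with $\mathbb C$ and write $u(\varphi)=(\cos\varphi,\sin\varphi)$. Let $K\subset\mathbb C$ be a strongly convex compact set with $C^3$ boundary: $K$ is compact and convex, and $\partial K$ is a simple closed curve with a positively oriented, $L$-periodic arc-length parametrization $\gamma:\mathbb R\to\partial K$ of class $C^3$ (injective on $[0,L)$, with $\gamma([0,L))=\partial K$, $\|\gamma'\|=1$, and $K$ to the left of $\gamma$) such that $\gamma''$ has no zero. Let $\kappa=\|\gamma''\|$ be the curvature, and assume that it has only finitely many stationary points, i.e. $\kappa'$ has only finitely many zeros in $[0,L)$. Let $O$ be any point in the plane. Let $p(\varphi)=\max_{X\in K}\langle X-O,u(\varphi)\rangle$ be the support function of $K$ centred at $O$, and let $z(\varphi)=O+p(\varphi)u(\varphi)+p'(\varphi)u'(\varphi)$ be the associated parametrization of $\partial K$. A horizontal equilibrium of $K$ with respect to $O$ is a point $z(\varphi)\in\partial K$ with $p'(\varphi)=0$. Let $e=\gamma+\gamma''/\|\gamma''\|^2$ be the evolute of $\partial K$ (the curve of its centres of curvature). Then the generalized winding number of the evolute about $O$, i.e. the Cauchy principal value $$m=\lim_{\varepsilon\searrow0}\frac1{2\pi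 i}\int_{\{s\in[0,L]\,:\,|e(s)-O|>\varepsilon\}}\frac{e'(s)}{e(s)-O}\,ds,$$ exists and satisfies $m\in\tfrac12\mathbb Z$ and $m\le 0$. The number $n$ of horizontal equilibria of $K$ with respect to $O$ is finite, equals the number of zeros of $p'$ in $[0,2\pi)$, and is given by $$n=2-2m.$$ The point $O$ may lie on the evolute, even at a cusp. -/

import Mathlib

open Set Filter Topology MeasureTheory

noncomputable section

namespace PlaneEquilibria

/-! The Euclidean plane is identified with `ℂ`, with real inner product `inner ℝ`; multiplication by
`Complex.I` is the counterclockwise rotation by a right angle. -/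

/-- The unit vector `u(φ) = (cos φ, sin φ)`. -/
def unitVec (φ : ℝ) : ℂ := ⟨Real.cos φ, Real.sin φ⟩

/-- `γ` is a positively oriented arc-length parametrization of class `C^n` of the boundary of the
convex set `K`, as a simple closed curve of length `L`. -/
structure IsBoundaryParam (n : ℕ) (K : Set ℂ) (L : ℝ) (γ : ℝ → ℂ) : Prop where
  length_pos : 0 < L
  contDiff : ContDiff ℝ n γ
  periodic : Function.Periodic γ L
  injOn : InjOn γ (Ico 0 L)
  image_eq : γ '' Ico 0 L = frontier K
  unit_speed : ∀ s, ‖deriv γ s‖ = 1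
  /-- `K` lies to the left of `γ`: the rotated tangent `i γ'(s)` is the inner normal of the convex
  set `K` at `γ(s)`. -/
  left : ∀ s, ∀ x ∈ K, 0 ≤ inner ℝ (Complex.I * deriv γ s) (x - γ s)

/-- The convex set `K` is strongly convex with boundary of class `C^n`, as witnessed by the
arc-length parametrization `γ` of its boundary, whose second derivative has no zero. -/
structure IsStronglyConvex (n : ℕ) (K : Set ℂ) (L : ℝ) (γ : ℝ → ℂ) : Prop where
  convex : Convex ℝ K
  param : IsBoundaryParam n K L γ
  accel_ne_zero : ∀ s, deriv (deriv γ) s ≠ 0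

/-- The curvature of a curve parametrized by arc length. -/
def curvature (γ : ℝ → ℂ) (s : ℝ) : ℝ := ‖deriv (deriv γ) s‖

/-- The unit normal of a curve parametrized by arc length, pointing to the centre of curvature. -/
def principalNormal (γ : ℝ → ℂ) (s : ℝ) : ℂ := (curvature γ s)⁻¹ • deriv (deriv γ) s

/-- The evolute of a curve parametrized by arc length: the curve of its centres of curvature. -/
def evolute (γ : ℝ → ℂ) (s : ℝ) : ℂ := γ s + (curvature γ s)⁻¹ • principalNormal γ s

/-- The support function of `K` with origin `O`. -/
def supportFun (K : Set ℂ) (O : ℂ) (φ : ℝ) : ℝ :=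
  sSup ((fun X : ℂ => inner ℝ (X - O) (unitVec φ)) '' K)

/-- The boundary point `z(φ) = p(φ) u(φ) + p'(φ) u'(φ)`, relative to the origin `O`, where `p` is
the support function with origin `O`. -/
def boundaryPoint (K : Set ℂ) (O : ℂ) (φ : ℝ) : ℂ :=
  O + supportFun K O φ • unitVec φ + deriv (supportFun K O) φ • (Complex.I * unitVec φ)

/-- The zeros in `[0, 2π)` of the derivative `p'` of the support function with origin `O`. -/
def equilibriumAngles (K : Set ℂ) (O : ℂ) : Set ℝ :=
  {φ ∈ Ico 0 (2 * Real.pi) | HasDerivAt (supportFun K O) 0 φ}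

/-- The horizontal equilibria of `K` with respect to `O`: the boundary points `z(φ)` with
`p'(φ) = 0`. -/
def horizontalEquilibria (K : Set ℂ) (O : ℂ) : Set ℂ :=
  {z ∈ frontier K | ∃ φ, HasDerivAt (supportFun K O) 0 φ ∧ z = boundaryPoint K O φ}

/-- `m` is the (generalized) winding number about `O` of the closed curve `c` on `[0, L]`, that is,
the Cauchy principal value of `(2πi)⁻¹ ∮ dz / (z - O)` along `c`. The point `O` may lie on `c`. -/
def HasWindingNumber (c : ℝ → ℂ) (L : ℝ) (O : ℂ) (m : ℝ) : Prop :=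
  Tendsto
    (fun ε : ℝ => (2 * Real.pi * Complex.I)⁻¹ *
      ∫ s in {s ∈ Ioc 0 L | ε < ‖c s - O‖}, deriv c s / (c s - O))
    (𝓝[>] 0) (𝓝 (m : ℂ))

end PlaneEquilibria

end

/-! Let `T = γ'`, let `N = iT` be the inner normal, and write `e - O = aT + cN`. The Frenet
equations give `a' = κc`, `c' = r - κa` and `e' = rN`, where `r = (1/κ)'`. Hence `e'/(e - O) = ir/(a
+ ic)`, with real part `rc/(a² + c²)` and imaginary part `ra/(a² + c²)`.

The real part is half the logarithmic derivative of `a² + c²`, so its truncated integral over a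
period vanishes exactly for every cutoff (`integral_truncated_logDeriv_eq_zero`). The imaginary part
is locally integrable even where the evolute meets `O` (`locallyIntegrable`), and away from the
zeros of `a` it equals `κ + (arctan (c/a))'`. Right of each zero of `a` the quotient `a/c` tends to
`0` from above, left of it from below (`tendsto_div_right` and its mirror image), so `arctan (c/a)`
drops from `π/2` to `-π/2` between consecutive zeros. Since `∫ κ = 2π`, a period contributes `2π -
πn`, with `n` the number of zeros of `a`, and `m = 1 - n/2`.

If `θ` is the angle of the outer normal, then `p'(θ(s)) = a(s)`, so `n` counts the equilibria.
Finally `a` is half the derivative of `‖γ - O‖²`, and Rolle's theorem gives `n ≥ 2`. -/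

namespace PlaneEquilibria

/-! ### The structure equations and their symmetries. -/

/-- Structure equations, in the moving frame of a curve with tangent angle `θ` and curvature `κ`,
of the tangential coordinate `a` and the (negated) normal coordinate `c` of its evolute, where `r`
is the derivative of the radius of curvature, whose zeros are isolated. -/
structure EvoluteSystem (θ κ a c r : ℝ → ℝ) : Prop where
  angle : ∀ s, HasDerivAt θ (κ s) s
  tangential : ∀ s, HasDerivAt a (κ s * c s) s
  normal : ∀ s, HasDerivAt c (r s - κ s * a s) s
  curv_pos : ∀ s, 0 < κ s
  curv_cont : Continuous κ
  rad_cont : Continuous r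
  rad_ne : ∀ s, ∀ᶠ t in 𝓝[≠] s, r t ≠ 0

namespace EvoluteSystem

variable {θ κ a c r : ℝ → ℝ}

lemma neg (h : EvoluteSystem θ κ a c r) :
    EvoluteSystem θ κ (fun s => -a s) (fun s => -c s) (fun s => -r s) where
  angle := h.angle
  tangential s := (h.tangential s).neg.congr_deriv (by ring)
  normal s := (h.normal s).neg.congr_deriv (by ring)
  curv_pos := h.curv_pos
  curv_cont := h.curv_cont
  rad_cont := h.rad_cont.neg
  rad_ne s := by simpa using h.rad_ne s

/-- Reversing the parameter turns every statement about right neighbourhoods into one about left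
neighbourhoods. -/
lemma reflect (h : EvoluteSystem θ κ a c r) :
    EvoluteSystem (fun s => -θ (-s)) (fun s => κ (-s)) (fun s => a (-s)) (fun s => -c (-s))
      (fun s => r (-s)) where
  angle s := ((h.angle (-s)).scomp s (hasDerivAt_neg s)).neg.congr_deriv (by simp)
  tangential s := ((h.tangential (-s)).scomp s (hasDerivAt_neg s)).congr_deriv (by simp)
  normal s := ((h.normal (-s)).scomp s (hasDerivAt_neg s)).neg.congr_deriv (by simp)
  curv_pos s := h.curv_pos _
  curv_cont := h.curv_cont.comp continuous_neg
  rad_cont := h.rad_cont.comp continuous_neg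
  rad_ne s := by
    have : Tendsto (fun t : ℝ => -t) (𝓝[≠] s) (𝓝[≠] (-s)) :=
      tendsto_nhdsWithin_of_tendsto_nhds_of_eventually_within _
        (continuous_neg.continuousAt.mono_left nhdsWithin_le_nhds)
        (by filter_upwards [self_mem_nhdsWithin] with t ht; simpa using ht)
    exact this.eventually (h.rad_ne (-s))

lemma continuous_angle (h : EvoluteSystem θ κ a c r) : Continuous θ :=
  continuous_iff_continuousAt.2 fun s => (h.angle s).continuousAt

lemma continuous_tangential (h : EvoluteSystem θ κ a c r) : Continuous a :=
  continuous_iff_continuousAt.2 fun s => (h.tangential s).continuousAt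

lemma continuous_normal (h : EvoluteSystem θ κ a c r) : Continuous c :=
  continuous_iff_continuousAt.2 fun s => (h.normal s).continuousAt

lemma strictMono_angle (h : EvoluteSystem θ κ a c r) : StrictMono θ :=
  strictMono_of_deriv_pos fun s => by rw [(h.angle s).deriv]; exact h.curv_pos s

/-! ### One-sided behaviour at the zeros of `a`. -/

/-- The component of the evolute in a fixed direction. -/
lemma hasDerivAt_component (h : EvoluteSystem θ κ a c r) (β s : ℝ) :
    HasDerivAt (fun t => c t * Real.cos (θ t - β) + a t * Real.sin (θ t - β))
      (r s * Real.cos (θ s - β)) s := by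
  have hθ := (h.angle s).sub_const β
  exact (((h.normal s).mul hθ.cos).add ((h.tangential s).mul hθ.sin)).congr_deriv (by ring)

lemma component_pos (h : EvoluteSystem θ κ a c r) {s₀ s β : ℝ} (ha : a s₀ = 0) (hc : c s₀ = 0)
    (hs : s₀ < s) (hr : ∀ t ∈ Ioo s₀ s, 0 < r t)
    (hcos : ∀ t ∈ Ioo s₀ s, 0 < Real.cos (θ t - β)) :
    0 < c s * Real.cos (θ s - β) + a s * Real.sin (θ s - β) := by
  have hmono : StrictMonoOn (fun t => c t * Real.cos (θ t - β) + a t * Real.sin (θ t - β))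
      (Icc s₀ s) := by
    refine strictMonoOn_of_deriv_pos (convex_Icc _ _)
      (fun t _ => (h.hasDerivAt_component β t).continuousAt.continuousWithinAt) fun t ht => ?_
    rw [interior_Icc] at ht
    rw [(h.hasDerivAt_component β t).deriv]
    exact mul_pos (hr t ht) (hcos t ht)
  simpa [ha, hc] using hmono (left_mem_Icc.2 hs.le) (right_mem_Icc.2 hs.le) hs

/-- Here the evolute passes through `O` at `s₀`, possibly at a cusp, where Taylor expansion may give
nothing. Instead, the component of `e - O` in a fixed direction increases as long as `r` and the
cosine are positive; three directions suffice. -/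
lemma pos_of_degenerate (h : EvoluteSystem θ κ a c r) {s₀ s : ℝ} (ha : a s₀ = 0) (hc : c s₀ = 0)
    (hs : s₀ < s) (hr : ∀ t ∈ Ioo s₀ s, 0 < r t) (hθ : θ s - θ s₀ < Real.pi / 2) :
    0 < a s ∧ 0 < c s ∧ a s / c s ≤ Real.tan (θ s - θ s₀) := by
  have hlt : ∀ t ∈ Ioo s₀ s, θ s₀ < θ t ∧ θ t < θ s := fun t ht =>
    ⟨h.strictMono_angle ht.1, h.strictMono_angle ht.2⟩
  -- The angles `β` are chosen so that the component at `s` is `c s`, then `a s`, then `c s * sin α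
  -- - a s * cos α` with `α = θ s - θ s₀`; the last gives the tangent bound.
  have hα : θ s₀ < θ s := h.strictMono_angle hs
  have h1 := h.component_pos (β := θ s) ha hc hs hr fun t ht =>
    Real.cos_pos_of_mem_Ioo ⟨by linarith [(hlt t ht).1], by linarith [(hlt t ht).2, Real.pi_pos]⟩
  have h2 := h.component_pos (β := θ s - Real.pi / 2) ha hc hs hr fun t ht =>
    Real.cos_pos_of_mem_Ioo ⟨by linarith [(hlt t ht).1], by linarith [(hlt t ht).2]⟩
  have h3 := h.component_pos (β := θ s₀ + Real.pi / 2) ha hc hs hr fun t ht =>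
    Real.cos_pos_of_mem_Ioo ⟨by linarith [(hlt t ht).1], by linarith [(hlt t ht).2, Real.pi_pos]⟩
  rw [← sub_sub, Real.cos_sub_pi_div_two, Real.sin_sub_pi_div_two] at h3
  simp only [sub_self, sub_sub_cancel, Real.cos_zero, Real.sin_zero, Real.cos_pi_div_two,
    Real.sin_pi_div_two, mul_one, mul_zero, add_zero, zero_add] at h1 h2
  have hcos : 0 < Real.cos (θ s - θ s₀) :=
    Real.cos_pos_of_mem_Ioo ⟨by linarith [Real.pi_pos], hθ⟩
  refine ⟨h2, h1, ?_⟩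
  rw [Real.tan_eq_sin_div_cos, div_le_div_iff₀ h1 hcos]
  linarith

/-- At a vertex `r s₀ = 0`, but isolated zeros and the intermediate value theorem still give `r` a
constant sign on one side. -/
lemma eventually_pos_or_neg (h : EvoluteSystem θ κ a c r) (s₀ : ℝ) :
    (∀ᶠ s in 𝓝[>] s₀, ∀ t ∈ Ioo s₀ s, 0 < r t) ∨ (∀ᶠ s in 𝓝[>] s₀, ∀ t ∈ Ioo s₀ s, r t < 0) := by
  obtain ⟨u, hu, hr⟩ := mem_nhdsGT_iff_exists_Ioo_subset.1
    ((h.rad_ne s₀).filter_mono (nhdsWithin_mono s₀ fun t ht => ne_of_gt ht))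
  have hmem : ∀ᶠ s in 𝓝[>] s₀, s ∈ Ioo s₀ u := Ioo_mem_nhdsGT hu
  by_cases hneg : ∃ x ∈ Ioo s₀ u, r x < 0
  · right
    filter_upwards [hmem] with s hs t ht
    by_contra! h0
    obtain ⟨x, hx, hx0⟩ := hneg
    obtain ⟨y, hy, hy0⟩ := isPreconnected_Ioo.intermediate_value hx ⟨ht.1, ht.2.trans hs.2⟩
      h.rad_cont.continuousOn ⟨hx0.le, h0⟩
    exact hr hy hy0
  · left
    push Not at hneg
    filter_upwards [hmem] with s hs t ht
    have := hr ⟨ht.1, ht.2.trans hs.2⟩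
    exact lt_of_le_of_ne (hneg t ⟨ht.1, ht.2.trans hs.2⟩) (Ne.symm this)

lemma eventually_angle_lt (h : EvoluteSystem θ κ a c r) (s₀ : ℝ) :
    ∀ᶠ s in 𝓝[>] s₀, θ s - θ s₀ < Real.pi / 2 := by
  have : ContinuousAt (fun s => θ s - θ s₀) s₀ :=
    (h.continuous_angle.sub continuous_const).continuousAt
  exact (this.eventually_lt continuousAt_const
    (by simpa using Real.pi_pos)).filter_mono nhdsWithin_le_nhds

/-- Both `r * a` and `a / c` are unchanged when `a`, `c`, `r` all change sign, so `r` may be taken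
positive. -/
lemma degenerate_right (h : EvoluteSystem θ κ a c r) {s₀ : ℝ} (ha : a s₀ = 0) (hc : c s₀ = 0) :
    ∀ᶠ s in 𝓝[>] s₀, 0 < r s * a s ∧ 0 < a s / c s ∧ a s / c s ≤ Real.tan (θ s - θ s₀) := by
  have key : ∀ {a c r : ℝ → ℝ}, EvoluteSystem θ κ a c r → a s₀ = 0 → c s₀ = 0 →
      (∀ᶠ s in 𝓝[>] s₀, ∀ t ∈ Ioo s₀ s, 0 < r t) →
      ∀ᶠ s in 𝓝[>] s₀, 0 < r s * a s ∧ 0 < a s / c s ∧ a s / c s ≤ Real.tan (θ s - θ s₀) := by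
    intro a c r h ha hc hr
    obtain ⟨u, hu, hr'⟩ := mem_nhdsGT_iff_exists_Ioo_subset.1 hr
    filter_upwards [Ioo_mem_nhdsGT hu, h.eventually_angle_lt s₀, self_mem_nhdsWithin]
      with s hs hθ hs0
    obtain ⟨h1, h2, h3⟩ := h.pos_of_degenerate ha hc hs0 (hr' hs) hθ
    -- Positivity of `r` is known on open intervals ending at a point; a point `v` beyond `s` is
    -- needed to cover `s` itself.
    obtain ⟨v, hv⟩ := exists_between hs.2
    exact ⟨mul_pos (hr' ⟨hs.1.trans hv.1, hv.2⟩ s ⟨hs.1, hv.1⟩) h1, div_pos h1 h2, h3⟩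
  rcases h.eventually_pos_or_neg s₀ with hr | hr
  · exact key h ha hc hr
  · simpa [neg_div_neg_eq] using key h.neg (by simpa using ha) (by simpa using hc) (by simpa using hr)

/-- If `c s₀ ≠ 0`, then `a / c` has derivative `κ s₀ > 0` at `s₀`. If `c s₀ = 0`, it is squeezed
between `0` and `tan (θ s - θ s₀)`. -/
lemma tendsto_div_right (h : EvoluteSystem θ κ a c r) {s₀ : ℝ} (ha : a s₀ = 0) :
    Tendsto (fun s => a s / c s) (𝓝[>] s₀) (𝓝[>] 0) := by
  by_cases hc : c s₀ = 0
  · have hev := h.degenerate_right ha hc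
    refine tendsto_nhdsWithin_of_tendsto_nhds_of_eventually_within _ ?_ (hev.mono fun s hs => hs.2.1)
    have htan : Tendsto (fun s => Real.tan (θ s - θ s₀)) (𝓝[>] s₀) (𝓝 0) := by
      have h1 : ContinuousAt (fun s => Real.tan (θ s - θ s₀)) s₀ :=
        ContinuousAt.comp (f := fun s => θ s - θ s₀) (g := Real.tan)
          (Real.continuousAt_tan.2 (by simp))
          (h.continuous_angle.sub continuous_const).continuousAt
      simpa [ContinuousAt] using h1.mono_left nhdsWithin_le_nhds
    exact tendsto_of_tendsto_of_tendsto_of_le_of_le' tendsto_const_nhds htan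
      (hev.mono fun s hs => hs.2.1.le) (hev.mono fun s hs => hs.2.2)
  · have hd := (h.tangential s₀).div (h.normal s₀) hc
    have hd' : HasDerivAt (fun s => a s / c s) (κ s₀) s₀ :=
      hd.congr_deriv (by rw [ha]; field_simp; ring)
    refine tendsto_nhdsWithin_of_tendsto_nhds_of_eventually_within _ ?_ ?_
    · simpa [ContinuousAt, ha] using hd'.continuousAt.mono_left nhdsWithin_le_nhds
    · have hs := (hasDerivAt_iff_tendsto_slope.1 hd').eventually (lt_mem_nhds (h.curv_pos s₀))
      filter_upwards [hs.filter_mono (nhdsWithin_mono s₀ fun t ht => ne_of_gt ht),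
        self_mem_nhdsWithin] with s hs hs0
      have hs1 : 0 < s - s₀ := sub_pos.2 hs0
      simpa [slope_def_field, ha, hs1] using hs

lemma tendsto_arctan_right (h : EvoluteSystem θ κ a c r) {s₀ : ℝ} (ha : a s₀ = 0) :
    Tendsto (fun s => Real.arctan (c s / a s)) (𝓝[>] s₀) (𝓝 (Real.pi / 2)) := by
  have h1 := tendsto_inv_nhdsGT_zero.comp (h.tendsto_div_right ha)
  have h2 := (Real.tendsto_arctan_atTop.mono_right nhdsWithin_le_nhds).comp h1
  refine h2.congr fun s => ?_
  simp

lemma tendsto_arctan_left (h : EvoluteSystem θ κ a c r) {s₀ : ℝ} (ha : a s₀ = 0) :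
    Tendsto (fun s => Real.arctan (c s / a s)) (𝓝[<] s₀) (𝓝 (-(Real.pi / 2))) := by
  have h1 := (h.reflect.tendsto_arctan_right (s₀ := -s₀) (by simpa using ha)).neg
  have h2 : Tendsto (fun s : ℝ => -s) (𝓝[<] s₀) (𝓝[>] (-s₀)) := tendsto_neg_nhdsLT
  refine (h1.comp h2).congr fun s => ?_
  simp [neg_div]

lemma eventually_ne_right (h : EvoluteSystem θ κ a c r) {s₀ : ℝ} (ha : a s₀ = 0) :
    ∀ᶠ s in 𝓝[>] s₀, a s ≠ 0 := by
  filter_upwards [(h.tendsto_div_right ha).eventually self_mem_nhdsWithin] with s hs h0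
  simp [h0] at hs

lemma eventually_ne (h : EvoluteSystem θ κ a c r) (s₀ : ℝ) : ∀ᶠ s in 𝓝[≠] s₀, a s ≠ 0 := by
  by_cases ha : a s₀ = 0
  · rw [← nhdsLT_sup_nhdsGT, eventually_sup]
    refine ⟨?_, h.eventually_ne_right ha⟩
    have h1 := h.reflect.eventually_ne_right (s₀ := -s₀) (by simpa using ha)
    have h2 : Tendsto (fun s : ℝ => -s) (𝓝[<] s₀) (𝓝[>] (-s₀)) := tendsto_neg_nhdsLT
    simpa using h2.eventually h1
  · exact (h.continuous_tangential.continuousAt.eventually_ne ha).filter_mono nhdsWithin_le_nhds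

lemma finite_zeros (h : EvoluteSystem θ κ a c r) (A B : ℝ) : {s ∈ Icc A B | a s = 0}.Finite := by
  by_contra hinf
  obtain ⟨x, -, hx⟩ := Set.Infinite.exists_accPt_of_subset_isCompact hinf isCompact_Icc
    (sep_subset _ _)
  rw [accPt_iff_frequently_nhdsNE] at hx
  obtain ⟨y, hy, hy'⟩ := (hx.and_eventually (h.eventually_ne x)).exists
  exact hy' hy.2

/-! ### The angular part of the integral. -/

/-- The imaginary part of the logarithmic derivative of the evolute. -/
lemma hasDerivAt_arctan (h : EvoluteSystem θ κ a c r) {s : ℝ} (ha : a s ≠ 0) :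
    HasDerivAt (fun t => Real.arctan (c t / a t))
      (r s * a s / (a s ^ 2 + c s ^ 2) - κ s) s := by
  have : 0 < a s ^ 2 + c s ^ 2 := by positivity
  refine ((h.normal s).div (h.tangential s) ha).arctan.congr_deriv ?_
  simp only [Pi.div_apply]
  field_simp
  ring

lemma measurable_angularSpeed (h : EvoluteSystem θ κ a c r) :
    Measurable fun s => r s * a s / (a s ^ 2 + c s ^ 2) := by
  have := h.continuous_tangential.measurable
  have := h.continuous_normal.measurable
  have := h.rad_cont.measurable
  fun_prop

/-- The integrand is positive near `s₀` on the right and has the primitive `arctan (c/a) + θ`, which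
has a finite limit there; a nonnegative derivative of a continuous function is integrable. -/
lemma integrableAtFilter_right (h : EvoluteSystem θ κ a c r) {s₀ : ℝ} (ha : a s₀ = 0)
    (hc : c s₀ = 0) :
    IntegrableAtFilter (fun s => r s * a s / (a s ^ 2 + c s ^ 2)) (𝓝[>] s₀) := by
  obtain ⟨u, hu, hr⟩ := mem_nhdsGT_iff_exists_Ioo_subset.1
    ((h.degenerate_right ha hc).and (h.eventually_ne_right ha))
  obtain ⟨v, hv, hvu⟩ := exists_between (mem_Ioi.1 hu)
  refine ⟨Ioc s₀ v, Ioc_mem_nhdsGT hv, ?_⟩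
  have hd : ∀ s ∈ Ioo s₀ u, HasDerivAt (fun t => Real.arctan (c t / a t) + θ t)
      (r s * a s / (a s ^ 2 + c s ^ 2)) s := fun s hs =>
    ((h.hasDerivAt_arctan (hr hs).2).add (h.angle s)).congr_deriv (by ring)
  -- At `s₀` the expression `c / a` is `0` by the convention for division by zero, so the primitive
  -- must be redefined there by its limit.
  refine intervalIntegral.integrableOn_deriv_of_nonneg
    (g := Function.update (fun t => Real.arctan (c t / a t) + θ t) s₀ (Real.pi / 2 + θ s₀))
    ?_ ?_ ?_
  · rw [continuousOn_update_iff]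
    constructor
    · rintro s ⟨hs, hs'⟩
      exact (hd s ⟨lt_of_le_of_ne hs.1 (Ne.symm hs'), hs.2.trans_lt hvu⟩).continuousAt.continuousWithinAt
    · intro _
      refine ((h.tendsto_arctan_right ha).add
        (h.continuous_angle.continuousAt.mono_left nhdsWithin_le_nhds)).mono_left
        (nhdsWithin_mono _ fun s hs => lt_of_le_of_ne hs.1.1 (Ne.symm hs.2))
  · intro s hs
    refine (hd s ⟨hs.1, hs.2.trans hvu⟩).congr_of_eventuallyEq ?_
    filter_upwards [eventually_ne_nhds hs.1.ne'] with t ht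
    simp [ht]
  · intro s hs
    have := (hr ⟨hs.1, hs.2.trans hvu⟩).1.1
    positivity

lemma integrableAtFilter_left (h : EvoluteSystem θ κ a c r) {s₀ : ℝ} (ha : a s₀ = 0)
    (hc : c s₀ = 0) :
    IntegrableAtFilter (fun s => r s * a s / (a s ^ 2 + c s ^ 2)) (𝓝[<] s₀) := by
  obtain ⟨t, ht, hi⟩ := h.reflect.integrableAtFilter_right (s₀ := -s₀) (by simpa using ha)
    (by simpa using hc)
  refine ⟨Neg.neg ⁻¹' t, tendsto_neg_nhdsLT ht, ?_⟩
  have := ((Measure.measurePreserving_neg (volume : Measure ℝ)).integrableOn_comp_preimage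
    (MeasurableEquiv.neg ℝ).measurableEmbedding).2 hi
  simpa [Function.comp_def] using this

lemma locallyIntegrable (h : EvoluteSystem θ κ a c r) :
    LocallyIntegrable fun s => r s * a s / (a s ^ 2 + c s ^ 2) := by
  intro s₀
  by_cases h0 : a s₀ = 0 ∧ c s₀ = 0
  · have hpt : IntegrableAtFilter (fun s => r s * a s / (a s ^ 2 + c s ^ 2)) (pure s₀) volume :=
      ⟨{s₀}, by simp, by simp⟩
    have hne := IntegrableAtFilter.sup_iff.2
      ⟨h.integrableAtFilter_left h0.1 h0.2, h.integrableAtFilter_right h0.1 h0.2⟩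
    rw [nhdsLT_sup_nhdsGT] at hne
    rw [← pure_sup_nhdsNE]
    exact IntegrableAtFilter.sup_iff.2 ⟨hpt, hne⟩
  · have hpos : a s₀ ^ 2 + c s₀ ^ 2 ≠ 0 := fun h1 =>
      h0 ⟨by nlinarith [sq_nonneg (a s₀), sq_nonneg (c s₀)],
        by nlinarith [sq_nonneg (a s₀), sq_nonneg (c s₀)]⟩
    have hcont : ContinuousAt (fun s => r s * a s / (a s ^ 2 + c s ^ 2)) s₀ := by
      have := h.continuous_tangential
      have := h.continuous_normal
      have := h.rad_cont
      exact ContinuousAt.div (by fun_prop) (by fun_prop) hpos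
    exact Tendsto.integrableAtFilter
      h.measurable_angularSpeed.stronglyMeasurable.stronglyMeasurableAtFilter
      (volume.finiteAt_nhds s₀) hcont

/-- Between two zeros of `a`, the evolute turns by half a turn for each gap between consecutive
zeros, relative to the moving frame. -/
lemma integral_eq (h : EvoluteSystem θ κ a c r) {A B : ℝ} (hAB : A < B) (hA : a A = 0)
    (hB : a B = 0) :
    ∫ s in A..B, (r s * a s / (a s ^ 2 + c s ^ 2) - κ s) =
      -Real.pi * {s ∈ Ico A B | a s = 0}.ncard := by
  have hint : ∀ A B, IntervalIntegrable (fun s => r s * a s / (a s ^ 2 + c s ^ 2) - κ s)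
      volume A B := fun A B =>
    (h.locallyIntegrable.integrableOn_isCompact isCompact_uIcc).intervalIntegrable.sub
      (h.curv_cont.intervalIntegrable _ _)
  have hfin : ∀ A B, {s ∈ Ico A B | a s = 0}.Finite := fun A B =>
    (h.finite_zeros A B).subset fun s hs => ⟨Ico_subset_Icc_self hs.1, hs.2⟩
  induction hn : {s ∈ Ico A B | a s = 0}.ncard using Nat.strong_induction_on generalizing A B with
  | _ n ih =>
    by_cases hz : ∃ z ∈ Ioo A B, a z = 0
    · obtain ⟨z, hz, hz0⟩ := hz
      have hun : {s ∈ Ico A B | a s = 0} = {s ∈ Ico A z | a s = 0} ∪ {s ∈ Ico z B | a s = 0} := by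
        rw [← Ico_union_Ico_eq_Ico hz.1.le hz.2.le]
        ext s; simp only [mem_union, mem_ofPred_eq]; tauto
      have hdis : Disjoint {s ∈ Ico A z | a s = 0} {s ∈ Ico z B | a s = 0} :=
        disjoint_left.2 fun s hs hs' => absurd hs.1.2 (not_lt.2 hs'.1.1)
      have hcard := ncard_union_eq hdis (hfin _ _) (hfin _ _)
      rw [← hun, hn] at hcard
      -- Each half contains the zero at its left end, so both counts are smaller than `n`.
      have h1 : 0 < {s ∈ Ico A z | a s = 0}.ncard :=
        (ncard_pos (hfin _ _)).2 ⟨A, left_mem_Ico.2 hz.1, hA⟩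
      have h2 : 0 < {s ∈ Ico z B | a s = 0}.ncard :=
        (ncard_pos (hfin _ _)).2 ⟨z, left_mem_Ico.2 hz.2, hz0⟩
      rw [← intervalIntegral.integral_add_adjacent_intervals (hint A z) (hint z B),
        ih _ (by omega) hz.1 hA hz0 rfl, ih _ (by omega) hz.2 hz0 hB rfl, hcard]
      push_cast; ring
    · push Not at hz
      have : {s ∈ Ico A B | a s = 0} = {A} := by
        ext s
        constructor
        · rintro ⟨hs, hs0⟩
          by_contra hne
          exact hz s ⟨lt_of_le_of_ne hs.1 (Ne.symm hne), hs.2⟩ hs0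
        · rintro rfl
          exact ⟨left_mem_Ico.2 hAB, hA⟩
      rw [this, ncard_singleton] at hn
      -- With no zero inside, `arctan (c/a)` is a primitive running from `π/2` to `-π/2`.
      rw [intervalIntegral.integral_eq_sub_of_hasDerivAt_of_tendsto hAB
        (fun s hs => h.hasDerivAt_arctan (hz s hs)) (hint A B) (h.tendsto_arctan_right hA)
        (h.tendsto_arctan_left hB), ← hn]
      push_cast; ring

end EvoluteSystem

/-! ### The radial part of the integral. -/

/-- The logarithm of a positive quantity has no net change along a closed loop, even if small values
of that quantity are cut off. -/
lemma integral_truncated_logDeriv_eq_zero {q q' : ℝ → ℝ} {A B η : ℝ} (hη : 0 < η)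
    (hq : ∀ s, HasDerivAt q (q' s) s) (hq' : Continuous q') (hAB : q A = q B) :
    ∫ s in A..B, {s | η < q s}.indicator (fun s => q' s / q s) s = 0 := by
  have hqc : Continuous q := continuous_iff_continuousAt.2 fun s => (hq s).continuousAt
  -- Continuous functions bounded by `1/η` that converge pointwise to `1/x` for `x > η` and to `0`
  -- otherwise; for each of them substitution applies.
  set ψ : ℕ → ℝ → ℝ := fun k x => max 0 (min 1 (k * (x - η))) / max x η with hψ
  have hpos : ∀ x, 0 < max x η := fun x => lt_max_of_lt_right hη
  have hψc : ∀ k, Continuous (ψ k) := fun k => by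
    refine Continuous.div (by fun_prop) (by fun_prop) fun x => (hpos x).ne'
  have hzero : ∀ k, ∫ s in A..B, ψ k (q s) * q' s = 0 := fun k => by
    have := intervalIntegral.integral_comp_mul_deriv (a := A) (b := B) (fun x _ => hq x)
      hq'.continuousOn (hψc k)
    simpa [hAB] using this
  have hlim : Tendsto (fun k : ℕ => ∫ s in A..B, ψ k (q s) * q' s) atTop
      (𝓝 (∫ s in A..B, {s | η < q s}.indicator (fun s => q' s / q s) s)) := by
    refine intervalIntegral.tendsto_integral_filter_of_dominated_convergence
      (fun s => |q' s| / η) (.of_forall fun k => ?_) (.of_forall fun k => .of_forall fun s _ => ?_)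
      ((hq'.abs.div_const η).intervalIntegrable _ _) (.of_forall fun s _ => ?_)
    · exact (((hψc k).comp hqc).mul hq').aestronglyMeasurable
    · rw [norm_mul, Real.norm_eq_abs, Real.norm_eq_abs, mul_comm, div_eq_mul_inv]
      refine mul_le_mul_of_nonneg_left ?_ (abs_nonneg _)
      rw [hψ, abs_of_nonneg (by have := hpos (q s); positivity), ← one_div]
      exact div_le_div₀ zero_le_one (max_le zero_le_one (min_le_left _ _)) hη (le_max_right _ _)
    · by_cases hs : η < q s
      · rw [indicator_of_mem (by exact hs)]
        have hk : ∀ᶠ k : ℕ in atTop, 1 ≤ k * (q s - η) :=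
          ((tendsto_natCast_atTop_atTop (R := ℝ)).atTop_mul_const (sub_pos.2 hs)).eventually_ge_atTop 1
        refine tendsto_const_nhds.congr' ?_
        filter_upwards [hk] with k hk
        simp only [hψ]
        rw [min_eq_left hk, max_eq_right zero_le_one, max_eq_left hs.le]
        ring
      · rw [indicator_of_notMem (by exact hs)]
        refine tendsto_const_nhds.congr fun k => ?_
        have : (k : ℝ) * (q s - η) ≤ 0 :=
          mul_nonpos_of_nonneg_of_nonpos k.cast_nonneg (by linarith)
        simp only [hψ]
        rw [max_eq_left ((min_le_right _ _).trans this)]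
        simp
  simp only [hzero] at hlim
  exact (tendsto_nhds_unique hlim tendsto_const_nhds)

/-! ### Frames, periodic functions and unit vectors. -/

lemma re_sq_add_im_sq_of_norm_eq_one {t : ℂ} (ht : ‖t‖ = 1) : t.re ^ 2 + t.im ^ 2 = 1 := by
  have := Complex.sq_norm t
  rw [ht, Complex.normSq_apply] at this
  linarith

/-- Decomposition of a vector in the orthonormal frame `(t, i t)`. -/
lemma eq_frame {t : ℂ} (ht : ‖t‖ = 1) (z : ℂ) :
    z = (inner ℝ t z) • t + (inner ℝ (Complex.I * t) z) • (Complex.I * t) := by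
  have h1 := re_sq_add_im_sq_of_norm_eq_one ht
  apply Complex.ext <;> simp
  · linear_combination (-z.re) * h1
  · linear_combination (-z.im) * h1

lemma norm_I_mul (t : ℂ) : ‖Complex.I * t‖ = ‖t‖ := by simp

lemma inner_I_mul_self (t : ℂ) : inner ℝ (Complex.I * t) t = 0 := by
  simp; ring

lemma inner_self_of_norm_eq_one {t : ℂ} (ht : ‖t‖ = 1) : inner ℝ t t = (1 : ℝ) := by
  rw [real_inner_self_eq_norm_sq, ht, one_pow]

/-- Points with a given property in two period intervals correspond to each other. -/
lemma toIcoMod_image_sep {P : ℝ → Prop} {L : ℝ} (hL : 0 < L) (hP : Function.Periodic P L)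
    (t t' : ℝ) :
    toIcoMod hL t' '' {s ∈ Ico t (t + L) | P s} = {s ∈ Ico t' (t' + L) | P s} ∧
      InjOn (toIcoMod hL t') {s ∈ Ico t (t + L) | P s} := by
  have hmod : ∀ u s, P (toIcoMod hL u s) = P s := fun u s => hP.sub_zsmul_eq (toIcoDiv hL u s)
  have hback : ∀ u s u', s ∈ Ico u (u + L) → toIcoMod hL u (toIcoMod hL u' s) = s :=
    fun u s u' hs => by rw [toIcoMod_toIcoMod, toIcoMod_eq_self]; exact hs
  constructor
  · ext s
    constructor
    · rintro ⟨x, ⟨-, hx⟩, rfl⟩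
      exact ⟨toIcoMod_mem_Ico hL t' x, by rwa [hmod]⟩
    · rintro ⟨hs, hs'⟩
      exact ⟨toIcoMod hL t s, ⟨toIcoMod_mem_Ico hL t s, by rwa [hmod]⟩, hback _ _ _ hs⟩
  · intro x hx y hy hxy
    rw [← hback t x t' hx.1, hxy, hback t y t' hy.1]

lemma ncard_sep_Ico_periodic {P : ℝ → Prop} {L : ℝ} (hL : 0 < L) (hP : Function.Periodic P L)
    (t t' : ℝ) : {s ∈ Ico t (t + L) | P s}.ncard = {s ∈ Ico t' (t' + L) | P s}.ncard := by
  obtain ⟨h1, h2⟩ := toIcoMod_image_sep hL hP t t'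
  rw [← h1, h2.ncard_image]

lemma finite_sep_Ico_periodic {P : ℝ → Prop} {L : ℝ} (hL : 0 < L) (hP : Function.Periodic P L)
    {t : ℝ} (ht : {s ∈ Ico t (t + L) | P s}.Finite) (t' : ℝ) :
    {s ∈ Ico t' (t' + L) | P s}.Finite := by
  rw [← (toIcoMod_image_sep hL hP t t').1]
  exact ht.image _

lemma eventually_not_of_finite_periodic {P : ℝ → Prop} {L : ℝ} (hL : 0 < L)
    (hP : Function.Periodic P L) {t : ℝ} (ht : {s ∈ Ico t (t + L) | P s}.Finite) (s : ℝ) :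
    ∀ᶠ x in 𝓝[≠] s, ¬ P x := by
  have hfin := (finite_sep_Ico_periodic hL hP ht (s - L / 2)).subset
    (sdiff_subset (t := {s}))
  have h1 := hfin.isClosed.isOpen_compl.mem_nhds (x := s) (by simp)
  have h2 : Ico (s - L / 2) (s - L / 2 + L) ∈ 𝓝 s := Ico_mem_nhds (by linarith) (by linarith)
  rw [eventually_nhdsWithin_iff]
  filter_upwards [h1, h2] with x hx1 hx2 hx3 hx4
  exact hx1 ⟨⟨hx2, hx4⟩, hx3⟩

lemma Periodic.deriv {E : Type*} [NormedAddCommGroup E] [NormedSpace ℝ E] {f : ℝ → E} {L : ℝ}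
    (hf : Function.Periodic f L) : Function.Periodic (deriv f) L := fun s => by
  rw [← deriv_comp_add_const, funext hf]

lemma hasDerivAt_unitVec (φ : ℝ) : HasDerivAt unitVec (Complex.I * unitVec φ) φ := by
  have h : unitVec = fun φ : ℝ => ((Real.cos φ : ℝ) : ℂ) + ((Real.sin φ : ℝ) : ℂ) * Complex.I := by
    ext φ; apply Complex.ext <;> simp [unitVec, Complex.cos_ofReal_re, Complex.sin_ofReal_re]
  rw [h]
  refine ((Real.hasDerivAt_cos φ).ofReal_comp.add
    ((Real.hasDerivAt_sin φ).ofReal_comp.mul_const Complex.I)).congr_deriv ?_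
  push_cast
  linear_combination (-Complex.sin φ) * Complex.I_mul_I

lemma norm_unitVec (φ : ℝ) : ‖unitVec φ‖ = 1 := by
  rw [← sq_eq_sq₀ (norm_nonneg _) zero_le_one, Complex.sq_norm, Complex.normSq_apply]
  simp [unitVec, ← sq]

lemma unitVec_eq_iff {φ ψ : ℝ} : unitVec φ = unitVec ψ ↔ ∃ k : ℤ, φ - ψ = 2 * Real.pi * k := by
  rw [← Real.Angle.angle_eq_iff_two_pi_dvd_sub]
  constructor
  · intro h
    have h1 : Real.cos φ = Real.cos ψ := by
      simpa [unitVec] using congrArg Complex.re h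
    have h2 : Real.sin φ = Real.sin ψ := by
      simpa [unitVec] using congrArg Complex.im h
    exact Real.Angle.cos_sin_inj h1 h2
  · intro h
    have h1 := congrArg Real.Angle.cos h
    have h2 := congrArg Real.Angle.sin h
    simp only [Real.Angle.cos_coe, Real.Angle.sin_coe] at h1 h2
    exact Complex.ext h1 h2

/-! ### Curvature and evolute of the boundary curve. -/

namespace IsStronglyConvex

variable {K : Set ℂ} {L : ℝ} {γ : ℝ → ℂ}

lemma hasDerivAt (h : IsStronglyConvex 3 K L γ) (s : ℝ) : HasDerivAt γ (deriv γ s) s :=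
  (h.param.contDiff.differentiable (by norm_num) s).hasDerivAt

lemma contDiff_tangent (h : IsStronglyConvex 3 K L γ) : ContDiff ℝ 2 (deriv γ) := by
  have h1 : ContDiff ℝ (2 + 1) γ := by simpa [two_add_one_eq_three] using h.param.contDiff
  exact (contDiff_succ_iff_deriv.1 h1).2.2

lemma contDiff_accel (h : IsStronglyConvex 3 K L γ) : ContDiff ℝ 1 (deriv (deriv γ)) := by
  have h1 : ContDiff ℝ (1 + 1) (deriv γ) := by simpa [one_add_one_eq_two] using h.contDiff_tangent
  exact (contDiff_succ_iff_deriv.1 h1).2.2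

lemma contDiff_curvature (h : IsStronglyConvex 3 K L γ) : ContDiff ℝ 1 (curvature γ) :=
  h.contDiff_accel.norm ℝ h.accel_ne_zero

lemma curvature_pos (h : IsStronglyConvex 3 K L γ) (s : ℝ) : 0 < curvature γ s :=
  norm_pos_iff.2 (h.accel_ne_zero s)

lemma periodic_curvature (h : IsStronglyConvex 3 K L γ) : Function.Periodic (curvature γ) L :=
  fun s => by rw [curvature, (Periodic.deriv (Periodic.deriv h.param.periodic)) s, curvature]

lemma mem_frontier (h : IsStronglyConvex 3 K L γ) (s : ℝ) : γ s ∈ frontier K := by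
  obtain ⟨t, ht, hts⟩ := h.param.periodic.exists_mem_Ico₀ h.param.length_pos s
  rw [hts, ← h.param.image_eq]
  exact mem_image_of_mem _ ht

lemma mem (h : IsStronglyConvex 3 K L γ) (hK : IsCompact K) (s : ℝ) : γ s ∈ K :=
  hK.isClosed.frontier_subset (h.mem_frontier s)

lemma hasDerivAt_tangent_aux (h : IsStronglyConvex 3 K L γ) (s : ℝ) :
    HasDerivAt (deriv γ) (deriv (deriv γ) s) s :=
  (h.contDiff_tangent.differentiable (by norm_num) s).hasDerivAt

/-- The height of `γ` above its tangent line at `s` is nonnegative and vanishes at `s` to first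
order. A negative second derivative would make `s` a local maximum, hence the height locally zero, a
contradiction. -/
lemma inner_normal_accel_nonneg (h : IsStronglyConvex 3 K L γ) (hK : IsCompact K) (s : ℝ) :
    0 ≤ inner ℝ (Complex.I * deriv γ s) (deriv (deriv γ) s) := by
  set N := Complex.I * deriv γ s with hN
  have hg : ∀ t, HasDerivAt (fun t => inner ℝ N (γ t - γ s)) (inner ℝ N (deriv γ t)) t := fun t => by
    simpa using (hasDerivAt_const t N).inner ℝ ((h.hasDerivAt t).sub_const (γ s))
  have hg' : ∀ t, HasDerivAt (fun t => inner ℝ N (deriv γ t)) (inner ℝ N (deriv (deriv γ) t)) t :=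
    fun t => by simpa using (hasDerivAt_const t N).inner ℝ (h.hasDerivAt_tangent_aux t)
  have hd : deriv (fun t => inner ℝ N (γ t - γ s)) = fun t => inner ℝ N (deriv γ t) :=
    funext fun t => (hg t).deriv
  by_contra! hneg
  have hmax : IsLocalMax (fun t => inner ℝ N (γ t - γ s)) s := by
    refine isLocalMax_of_deriv_deriv_neg ?_ ?_ (hg s).continuousAt
    · rw [hd, (hg' s).deriv]; exact hneg
    · rw [hd]; exact inner_I_mul_self _
  have hzero : (fun t => inner ℝ N (γ t - γ s)) =ᶠ[𝓝 s] fun _ => 0 := by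
    filter_upwards [hmax] with t ht
    exact le_antisymm (by simpa using ht) (h.param.left s _ (h.mem hK t))
  have h1 := hzero.deriv
  rw [hd] at h1
  have h2 := h1.deriv_eq
  rw [(hg' s).deriv] at h2
  simp only [deriv_const'] at h2
  exact hneg.ne h2

/-- Unit speed makes the acceleration orthogonal to the tangent, and convexity fixes its sign. -/
lemma accel_eq (h : IsStronglyConvex 3 K L γ) (hK : IsCompact K) (s : ℝ) :
    deriv (deriv γ) s = curvature γ s • (Complex.I * deriv γ s) := by
  have h0 : inner ℝ (deriv γ s) (deriv (deriv γ) s) = 0 := by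
    have h1 := (h.hasDerivAt_tangent_aux s).inner ℝ (h.hasDerivAt_tangent_aux s)
    have h2 : (fun t => inner ℝ (deriv γ t) (deriv γ t)) = fun _ => (1 : ℝ) :=
      funext fun t => inner_self_of_norm_eq_one (h.param.unit_speed t)
    rw [h2] at h1
    have h3 := h1.unique (hasDerivAt_const s 1)
    rw [real_inner_comm (deriv γ s)] at h3
    linarith
  have h1 := eq_frame (h.param.unit_speed s) (deriv (deriv γ) s)
  rw [h0, zero_smul, zero_add] at h1
  have h2 : curvature γ s = inner ℝ (Complex.I * deriv γ s) (deriv (deriv γ) s) := by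
    rw [curvature]
    conv_lhs => rw [h1]
    rw [norm_smul, norm_I_mul, h.param.unit_speed, mul_one, Real.norm_eq_abs,
      abs_of_nonneg (h.inner_normal_accel_nonneg hK s)]
  rw [h2, ← h1]

lemma hasDerivAt_tangent (h : IsStronglyConvex 3 K L γ) (hK : IsCompact K) (s : ℝ) :
    HasDerivAt (deriv γ) (curvature γ s • (Complex.I * deriv γ s)) s := by
  rw [← h.accel_eq hK]; exact h.hasDerivAt_tangent_aux s

lemma hasDerivAt_normal (h : IsStronglyConvex 3 K L γ) (hK : IsCompact K) (s : ℝ) :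
    HasDerivAt (fun s => Complex.I * deriv γ s) (-(curvature γ s • deriv γ s)) s := by
  refine ((h.hasDerivAt_tangent hK s).const_mul Complex.I).congr_deriv ?_
  rw [mul_smul_comm, ← mul_assoc, Complex.I_mul_I, neg_one_mul, smul_neg]

lemma hasDerivAt_inner_tangent (h : IsStronglyConvex 3 K L γ) (hK : IsCompact K) (O : ℂ) (s : ℝ) :
    HasDerivAt (fun s => inner ℝ (deriv γ s) (γ s - O))
      (1 + curvature γ s * inner ℝ (Complex.I * deriv γ s) (γ s - O)) s := by
  refine ((h.hasDerivAt_tangent hK s).inner ℝ ((h.hasDerivAt s).sub_const O)).congr_deriv ?_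
  rw [inner_self_of_norm_eq_one (h.param.unit_speed s), real_inner_smul_left]

lemma hasDerivAt_inner_normal (h : IsStronglyConvex 3 K L γ) (hK : IsCompact K) (O : ℂ) (s : ℝ) :
    HasDerivAt (fun s => inner ℝ (Complex.I * deriv γ s) (γ s - O))
      (-(curvature γ s * inner ℝ (deriv γ s) (γ s - O))) s := by
  refine ((h.hasDerivAt_normal hK s).inner ℝ ((h.hasDerivAt s).sub_const O)).congr_deriv ?_
  rw [inner_I_mul_self, inner_neg_left, real_inner_smul_left, zero_add]

/-- A tangent line of a strongly convex set touches it in a single point. -/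
lemma eq_of_inner_normal_eq_zero (h : IsStronglyConvex 3 K L γ) (hK : IsCompact K) {x : ℂ}
    (hx : x ∈ K) {s : ℝ} (h0 : inner ℝ (Complex.I * deriv γ s) (γ s - x) = 0) : γ s = x := by
  have hmax : IsLocalMax (fun s => inner ℝ (Complex.I * deriv γ s) (γ s - x)) s := by
    refine .of_forall fun t => ?_
    have := h.param.left t x hx
    rw [← neg_sub, inner_neg_right] at this
    simp only [h0]
    linarith
  have h1 := hmax.hasDerivAt_eq_zero (h.hasDerivAt_inner_normal hK x s)
  have h2 : inner ℝ (deriv γ s) (γ s - x) = 0 := by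
    simpa [(h.curvature_pos s).ne'] using h1
  have h3 := eq_frame (h.param.unit_speed s) (γ s - x)
  rw [h0, h2, zero_smul, zero_smul, add_zero] at h3
  exact sub_eq_zero.1 h3

lemma evolute_eq (h : IsStronglyConvex 3 K L γ) (hK : IsCompact K) :
    evolute γ = fun s => γ s + (curvature γ s)⁻¹ • (Complex.I * deriv γ s) := by
  ext1 s
  rw [evolute, principalNormal, h.accel_eq hK, inv_smul_smul₀ (h.curvature_pos s).ne']

lemma hasDerivAt_radius (h : IsStronglyConvex 3 K L γ) (s : ℝ) :
    HasDerivAt (fun s => (curvature γ s)⁻¹)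
      (-deriv (curvature γ) s / curvature γ s ^ 2) s :=
  ((h.contDiff_curvature.differentiable one_ne_zero s).hasDerivAt).inv (h.curvature_pos s).ne'

lemma hasDerivAt_evolute (h : IsStronglyConvex 3 K L γ) (hK : IsCompact K) (s : ℝ) :
    HasDerivAt (evolute γ)
      ((-deriv (curvature γ) s / curvature γ s ^ 2) • (Complex.I * deriv γ s)) s := by
  rw [h.evolute_eq hK]
  refine ((h.hasDerivAt s).add ((h.hasDerivAt_radius s).smul (h.hasDerivAt_normal hK s))).congr_deriv ?_
  rw [smul_neg, inv_smul_smul₀ (h.curvature_pos s).ne']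
  abel

lemma evolute_sub (h : IsStronglyConvex 3 K L γ) (hK : IsCompact K) (O : ℂ) (s : ℝ) :
    evolute γ s - O = inner ℝ (deriv γ s) (γ s - O) • deriv γ s +
      (inner ℝ (Complex.I * deriv γ s) (γ s - O) + (curvature γ s)⁻¹) •
        (Complex.I * deriv γ s) := by
  rw [h.evolute_eq hK, add_smul, ← add_assoc, ← eq_frame (h.param.unit_speed s)]
  ring

lemma norm_evolute_sub_sq (h : IsStronglyConvex 3 K L γ) (hK : IsCompact K) (O : ℂ) (s : ℝ) :
    ‖evolute γ s - O‖ ^ 2 = inner ℝ (deriv γ s) (γ s - O) ^ 2 +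
      (inner ℝ (Complex.I * deriv γ s) (γ s - O) + (curvature γ s)⁻¹) ^ 2 := by
  have h1 := re_sq_add_im_sq_of_norm_eq_one (h.param.unit_speed s)
  rw [h.evolute_sub hK]
  generalize inner ℝ (deriv γ s) (γ s - O) = a
  generalize inner ℝ (Complex.I * deriv γ s) (γ s - O) + (curvature γ s)⁻¹ = c
  rw [Complex.sq_norm, Complex.normSq_apply]
  simp
  linear_combination (a ^ 2 + c ^ 2) * h1

/-- The common factor `γ'` cancels, leaving `ir / (a + ic)`. -/
lemma evolute_logDeriv (h : IsStronglyConvex 3 K L γ) (hK : IsCompact K) (O : ℂ) (s : ℝ)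
    {r a c : ℝ} (hr : r = -deriv (curvature γ) s / curvature γ s ^ 2)
    (ha : a = inner ℝ (deriv γ s) (γ s - O))
    (hc : c = inner ℝ (Complex.I * deriv γ s) (γ s - O) + (curvature γ s)⁻¹) :
    deriv (evolute γ) s / (evolute γ s - O) =
      ((r * c / (a ^ 2 + c ^ 2) : ℝ) : ℂ) + ((r * a / (a ^ 2 + c ^ 2) : ℝ) : ℂ) * Complex.I := by
  have ht : deriv γ s ≠ 0 := norm_ne_zero_iff.1 (by rw [h.param.unit_speed]; exact one_ne_zero)
  rw [(h.hasDerivAt_evolute hK s).deriv, h.evolute_sub hK, ← hr, ← ha, ← hc]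
  -- When the evolute is at `O`, both sides are `0` by the convention for division by zero.
  by_cases h0 : a ^ 2 + c ^ 2 = 0
  · have ha0 : a = 0 := by nlinarith [sq_nonneg a, sq_nonneg c]
    have hc0 : c = 0 := by nlinarith [sq_nonneg a, sq_nonneg c]
    simp [ha0, hc0]
  · have h1 : (a : ℂ) + c * Complex.I ≠ 0 := fun h1 => by
      apply h0
      have h2 := congrArg Complex.re h1
      have h3 := congrArg Complex.im h1
      simp at h2 h3
      rw [h2, h3]; ring
    have h2 : ((a : ℂ) ^ 2 + (c : ℂ) ^ 2) ≠ 0 := by exact_mod_cast h0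
    have h3 : a • deriv γ s + c • (Complex.I * deriv γ s) =
        ((a : ℂ) + c * Complex.I) * deriv γ s := by
      simp only [Complex.real_smul]; ring
    rw [h3, div_eq_iff (mul_ne_zero h1 ht), Complex.real_smul]
    push_cast
    field_simp
    linear_combination (-(r * a * c : ℂ)) * Complex.I_sq

/-- The tangential and normal coordinates of the evolute satisfy the structure equations. -/
lemma evoluteSystem (h : IsStronglyConvex 3 K L γ) (hK : IsCompact K)
    (hstat : {s ∈ Ico 0 L | deriv (curvature γ) s = 0}.Finite) (O : ℂ) {θ : ℝ → ℝ}
    (hθ : ∀ s, HasDerivAt θ (curvature γ s) s) :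
    EvoluteSystem θ (curvature γ) (fun s => inner ℝ (deriv γ s) (γ s - O))
      (fun s => inner ℝ (Complex.I * deriv γ s) (γ s - O) + (curvature γ s)⁻¹)
      (fun s => -deriv (curvature γ) s / curvature γ s ^ 2) where
  angle := hθ
  tangential s := (h.hasDerivAt_inner_tangent hK O s).congr_deriv (by
    rw [mul_add, mul_inv_cancel₀ (h.curvature_pos s).ne', add_comm])
  normal s := ((h.hasDerivAt_inner_normal hK O s).add (h.hasDerivAt_radius s)).congr_deriv
    (by ring)
  curv_pos := h.curvature_pos
  curv_cont := h.contDiff_curvature.continuous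
  rad_cont := ((h.contDiff_curvature.continuous_deriv le_rfl).neg).div
    (h.contDiff_curvature.continuous.pow 2) fun s => pow_ne_zero 2 (h.curvature_pos s).ne'
  rad_ne s := by
    have hP : Function.Periodic (fun s => deriv (curvature γ) s = 0) L := fun s => by
      simp only [(Periodic.deriv h.periodic_curvature) s]
    have := eventually_not_of_finite_periodic h.param.length_pos hP (t := 0)
      (by simpa using hstat) s
    filter_upwards [this] with t ht
    exact div_ne_zero (neg_ne_zero.2 ht) (pow_ne_zero 2 (h.curvature_pos t).ne')

/-! ### The normal angle and the support function. -/

/-- Integrating `κ` from the initial angle gives `θ`; then `γ' / unitVec θ` has derivative zero.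
Here `θ` is the angle of the outer normal. -/
lemma exists_normalAngle (h : IsStronglyConvex 3 K L γ) (hK : IsCompact K) :
    ∃ θ : ℝ → ℝ, (∀ s, HasDerivAt θ (curvature γ s) s) ∧
      ∀ s, deriv γ s = Complex.I * unitVec (θ s) := by
  have hκ := h.contDiff_curvature.continuous
  set z : ℂ := -Complex.I * deriv γ 0 with hz
  have hz1 : ‖z‖ = 1 := by rw [hz, norm_mul, h.param.unit_speed]; simp
  have hzarg : unitVec z.arg = z := by
    apply Complex.ext
    · simpa [unitVec, hz1] using Complex.norm_mul_cos_arg z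
    · simpa [unitVec, hz1] using Complex.norm_mul_sin_arg z
  set θ : ℝ → ℝ := fun s => z.arg + ∫ t in (0 : ℝ)..s, curvature γ t with hθ
  have hd : ∀ s, HasDerivAt θ (curvature γ s) s := fun s =>
    (intervalIntegral.integral_hasDerivAt_right (hκ.intervalIntegrable _ _)
      hκ.stronglyMeasurable.stronglyMeasurableAtFilter hκ.continuousAt).const_add _
  refine ⟨θ, hd, fun s => ?_⟩
  have hu : ∀ s, HasDerivAt (fun s => unitVec (θ s))
      (curvature γ s • (Complex.I * unitVec (θ s))) s := fun s =>
    (hasDerivAt_unitVec (θ s)).scomp s (hd s)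
  have hne : ∀ s, unitVec (θ s) ≠ 0 := fun s =>
    norm_ne_zero_iff.1 (by rw [norm_unitVec]; exact one_ne_zero)
  have hq : ∀ s, HasDerivAt (fun s => deriv γ s / unitVec (θ s)) 0 s := fun s =>
    ((h.hasDerivAt_tangent hK s).div (hu s) (hne s)).congr_deriv (by
      rw [div_eq_zero_iff]; left
      simp only [Complex.real_smul]; ring)
  have hconst := is_const_of_deriv_eq_zero (fun s => (hq s).differentiableAt)
    (fun s => (hq s).deriv) s 0
  have h0 : unitVec (θ 0) = z := by simp [hθ, hzarg]
  rw [div_eq_iff (hne s)] at hconst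
  rw [hconst]
  congr 1
  rw [div_eq_iff (hne 0), h0, hz, ← mul_assoc, mul_neg, Complex.I_mul_I, neg_neg, one_mul]

/-- The normal direction of a simple closed strongly convex curve turns exactly once. -/
lemma normalAngle_add_length (h : IsStronglyConvex 3 K L γ) (hK : IsCompact K) {θ : ℝ → ℝ}
    (hθ : ∀ s, HasDerivAt θ (curvature γ s) s) (hu : ∀ s, deriv γ s = Complex.I * unitVec (θ s))
    (s : ℝ) : θ (s + L) = θ s + 2 * Real.pi := by
  have hL := h.param.length_pos
  have hmono : StrictMono θ := strictMono_of_deriv_pos fun s => by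
    rw [(hθ s).deriv]; exact h.curvature_pos s
  have hcont : Continuous θ := continuous_iff_continuousAt.2 fun s => (hθ s).continuousAt
  have hd : ∀ s, HasDerivAt (fun s => θ (s + L) - θ s) 0 s := fun s =>
    (((hθ (s + L)).comp_add_const s L).sub (hθ s)).congr_deriv (by
      rw [h.periodic_curvature, sub_self])
  have hconst := is_const_of_deriv_eq_zero (fun s => (hd s).differentiableAt)
    (fun s => (hd s).deriv) s 0
  simp only [zero_add] at hconst
  have huL : unitVec (θ L) = unitVec (θ 0) := by
    have h1 := Periodic.deriv h.param.periodic 0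
    rw [zero_add, hu, hu] at h1
    exact mul_left_cancel₀ Complex.I_ne_zero h1
  obtain ⟨k, hk⟩ := unitVec_eq_iff.1 huL
  have hkpos : 0 < k := by
    have h1 : 0 < 2 * Real.pi * k := by rw [← hk]; exact sub_pos.2 (hmono hL)
    exact_mod_cast pos_of_mul_pos_right h1 (by positivity)
  have hk1 : k = 1 := by
    by_contra hne
    have hk2 : (2 : ℝ) ≤ k := by exact_mod_cast (by omega : 2 ≤ k)
    -- With two or more turns, some `t` in `(0, L)` has the same tangent vector as `0`. The two
    -- supporting lines then coincide and touch `K` in one point, contradicting injectivity.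
    obtain ⟨t, ht, ht'⟩ := intermediate_value_Ioo hL.le hcont.continuousOn
      (show θ 0 + 2 * Real.pi ∈ Ioo (θ 0) (θ L) from
        ⟨by linarith [Real.pi_pos], by nlinarith [Real.pi_pos]⟩)
    have hT : deriv γ t = deriv γ 0 := by
      rw [hu, hu, unitVec_eq_iff.2 ⟨1, by rw [ht']; push_cast; ring⟩]
    have h1 := h.param.left 0 _ (h.mem hK t)
    have h2 := h.param.left t _ (h.mem hK 0)
    rw [hT, ← neg_sub, inner_neg_right] at h2
    have h3 : γ t = γ 0 := h.eq_of_inner_normal_eq_zero hK (h.mem hK 0) (by rw [hT]; linarith)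
    exact ht.1.ne' (h.param.injOn ⟨ht.1.le, ht.2⟩ ⟨le_rfl, hL⟩ h3)
  rw [hk1] at hk
  push_cast at hk
  linarith

lemma normalAngle_surjective (h : IsStronglyConvex 3 K L γ) (hK : IsCompact K) {θ : ℝ → ℝ}
    (hθ : ∀ s, HasDerivAt θ (curvature γ s) s) (hu : ∀ s, deriv γ s = Complex.I * unitVec (θ s)) :
    Function.Surjective θ := by
  have hcont : Continuous θ := continuous_iff_continuousAt.2 fun s => (hθ s).continuousAt
  have hL := h.param.length_pos
  -- `θ` is linear plus periodic, hence unbounded in both directions.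
  have hper : Function.Periodic (fun s => θ s - 2 * Real.pi / L * s) L := fun s => by
    simp only [h.normalAngle_add_length hK hθ hu s]
    field_simp
    ring
  have hn : ∀ n : ℤ, θ (n * L) = θ 0 + 2 * Real.pi * n := fun n => by
    have h1 := hper.int_mul_eq n
    have h2 : 2 * Real.pi / L * (n * L) = 2 * Real.pi * n := by field_simp
    simp only [h2, mul_zero, sub_zero] at h1
    linarith
  intro φ
  obtain ⟨n, hn1⟩ := exists_int_lt ((φ - θ 0) / (2 * Real.pi))
  obtain ⟨m, hm1⟩ := exists_int_gt ((φ - θ 0) / (2 * Real.pi))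
  rw [lt_div_iff₀ Real.two_pi_pos] at hn1
  rw [div_lt_iff₀ Real.two_pi_pos] at hm1
  exact mem_range_of_exists_le_of_exists_ge hcont ⟨n * L, by rw [hn]; linarith⟩
    ⟨m * L, by rw [hn]; linarith⟩

lemma supportFun_normalAngle (h : IsStronglyConvex 3 K L γ) (hK : IsCompact K) (O : ℂ) {s φ : ℝ}
    (hu : deriv γ s = Complex.I * unitVec φ) :
    supportFun K O φ = -inner ℝ (Complex.I * deriv γ s) (γ s - O) := by
  have hN : Complex.I * deriv γ s = -unitVec φ := by
    rw [hu, ← mul_assoc, Complex.I_mul_I, neg_one_mul]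
  refine IsGreatest.csSup_eq ⟨⟨γ s, h.mem hK s, ?_⟩, ?_⟩
  · simp only
    rw [hN, inner_neg_left, neg_neg, real_inner_comm]
  · rintro _ ⟨x, hx, rfl⟩
    have h1 := h.param.left s x hx
    rw [show x - γ s = (x - O) - (γ s - O) by ring, inner_sub_right] at h1
    have h2 : inner ℝ (x - O) (unitVec φ) = -inner ℝ (Complex.I * deriv γ s) (x - O) := by
      rw [hN, inner_neg_left, neg_neg, real_inner_comm]
    simp only [h2]
    linarith

/-- Differentiating `p(θ(s)) = -⟨N, γ - O⟩` gives `κa`, and the inverse of `θ` contributes the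
factor `1/κ`. Thus equilibria correspond to zeros of `a`. -/
lemma hasDerivAt_supportFun (h : IsStronglyConvex 3 K L γ) (hK : IsCompact K) (O : ℂ) {θ : ℝ → ℝ}
    (hθ : ∀ s, HasDerivAt θ (curvature γ s) s) (hu : ∀ s, deriv γ s = Complex.I * unitVec (θ s))
    (s : ℝ) : HasDerivAt (supportFun K O) (inner ℝ (deriv γ s) (γ s - O)) (θ s) := by
  have hmono : StrictMono θ := strictMono_of_deriv_pos fun s => by
    rw [(hθ s).deriv]; exact h.curvature_pos s
  set e : ℝ ≃o ℝ := hmono.orderIsoOfSurjective θ (h.normalAngle_surjective hK hθ hu) with he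
  have hes : ∀ t, e.symm (θ t) = t := fun t => e.symm_apply_apply t
  have hse : ∀ φ, θ (e.symm φ) = φ := fun φ => e.apply_symm_apply φ
  have hsymm : HasDerivAt e.symm (curvature γ s)⁻¹ (θ s) :=
    HasDerivAt.of_local_left_inverse e.symm.continuous.continuousAt
      (by rw [hes]; exact hθ s) (h.curvature_pos s).ne' (.of_forall hse)
  have hp : supportFun K O =
      fun φ => -inner ℝ (Complex.I * deriv γ (e.symm φ)) (γ (e.symm φ) - O) :=
    funext fun φ => h.supportFun_normalAngle hK O (by rw [hu, hse])
  rw [hp]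
  have h1 := (h.hasDerivAt_inner_normal hK O s).neg
  rw [← hes s] at h1
  refine (HasDerivAt.scomp (θ s) h1 hsymm).congr_deriv ?_
  rw [hes, neg_neg, smul_eq_mul, inv_mul_cancel_left₀ (h.curvature_pos s).ne']

lemma boundaryPoint_normalAngle (h : IsStronglyConvex 3 K L γ) (hK : IsCompact K) (O : ℂ)
    {θ : ℝ → ℝ} (hθ : ∀ s, HasDerivAt θ (curvature γ s) s)
    (hu : ∀ s, deriv γ s = Complex.I * unitVec (θ s)) (s : ℝ) :
    boundaryPoint K O (θ s) = γ s := by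
  rw [boundaryPoint, (h.hasDerivAt_supportFun hK O hθ hu s).deriv,
    h.supportFun_normalAngle hK O (hu s), ← hu s]
  have hN : unitVec (θ s) = -(Complex.I * deriv γ s) := by
    rw [hu, ← mul_assoc, Complex.I_mul_I, neg_one_mul, neg_neg]
  rw [hN, smul_neg, neg_smul, neg_neg, add_assoc,
    add_comm (inner ℝ (Complex.I * deriv γ s) (γ s - O) • _),
    ← eq_frame (h.param.unit_speed s)]
  ring

end IsStronglyConvex

/-! ### The principal value over a period. -/

lemma intervalIntegrable_truncated_logDeriv {q q' : ℝ → ℝ} {η : ℝ} (hη : 0 < η)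
    (hq : Continuous q) (hq' : Continuous q') (A B : ℝ) :
    IntervalIntegrable ({s | η < q s}.indicator fun s => q' s / q s) volume A B := by
  refine ((hq'.abs.div_const η).intervalIntegrable A B).mono_fun ?_ (.of_forall fun s => ?_)
  · exact ((hq'.measurable.div hq.measurable).indicator
      (measurableSet_lt measurable_const hq.measurable)).aestronglyMeasurable
  · beta_reduce
    by_cases hs : η < q s
    · rw [indicator_of_mem (by exact hs), norm_div, Real.norm_eq_abs, Real.norm_eq_abs,
        Real.norm_eq_abs, abs_div, abs_abs, abs_of_pos hη, abs_of_pos (hη.trans hs)]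
      exact div_le_div_of_nonneg_left (abs_nonneg _) hη hs.le
    · rw [indicator_of_notMem (by exact hs), norm_zero]
      positivity

namespace EvoluteSystem

variable {θ κ a c r : ℝ → ℝ}

lemma hasDerivAt_normSq (h : EvoluteSystem θ κ a c r) (s : ℝ) :
    HasDerivAt (fun s => a s ^ 2 + c s ^ 2) (2 * (r s * c s)) s :=
  (((h.tangential s).pow 2).add ((h.normal s).pow 2)).congr_deriv (by
    push_cast; ring)

/-- The principal value integral of the logarithmic derivative of the evolute. -/
lemma tendsto_integral (h : EvoluteSystem θ κ a c r) {A B : ℝ} (hA : a A = a B) (hc : c A = c B) :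
    Tendsto (fun ε : ℝ => ∫ s in A..B, {s | ε ^ 2 < a s ^ 2 + c s ^ 2}.indicator
        (fun s => ((r s * c s / (a s ^ 2 + c s ^ 2) : ℝ) : ℂ) +
          ((r s * a s / (a s ^ 2 + c s ^ 2) : ℝ) : ℂ) * Complex.I) s) (𝓝[>] 0)
      (𝓝 (((∫ s in A..B, r s * a s / (a s ^ 2 + c s ^ 2) : ℝ) : ℂ) * Complex.I)) := by
  have hac := h.continuous_tangential
  have hcc := h.continuous_normal
  have hrc := h.rad_cont
  set q : ℝ → ℝ := fun s => a s ^ 2 + c s ^ 2 with hq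
  set f : ℝ → ℝ := fun s => r s * a s / (a s ^ 2 + c s ^ 2) with hf
  have hqc : Continuous q := by fun_prop
  have hq'c : Continuous fun s => 2 * (r s * c s) := by fun_prop
  have hfi : IntervalIntegrable f volume A B :=
    (h.locallyIntegrable.integrableOn_isCompact isCompact_uIcc).intervalIntegrable
  have hms : ∀ ε : ℝ, MeasurableSet {s | ε ^ 2 < q s} := fun ε =>
    measurableSet_lt measurable_const hqc.measurable
  have hfε : ∀ ε : ℝ, IntervalIntegrable ({s | ε ^ 2 < q s}.indicator f) volume A B := fun ε =>
    ⟨hfi.1.indicator (hms ε), hfi.2.indicator (hms ε)⟩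
  have hlim : Tendsto (fun ε : ℝ => ∫ s in A..B, {s | ε ^ 2 < q s}.indicator f s) (𝓝[>] 0)
      (𝓝 (∫ s in A..B, f s)) := by
    refine intervalIntegral.tendsto_integral_filter_of_dominated_convergence (fun s => ‖f s‖)
      (.of_forall fun ε => ?_) (.of_forall fun ε => .of_forall fun s _ => ?_) hfi.norm
      (.of_forall fun s _ => ?_)
    · exact (h.measurable_angularSpeed.indicator (hms ε)).aestronglyMeasurable
    · exact norm_indicator_le_norm_self _ _
    · by_cases hs : q s = 0
      · have hfs : f s = 0 := by
          change r s * a s / q s = 0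
          rw [hs, div_zero]
        refine tendsto_const_nhds.congr fun ε => ?_
        simp [indicator_apply, hfs]
      · have hs' : 0 < q s := lt_of_le_of_ne (by positivity) (Ne.symm hs)
        have hε : ∀ᶠ ε : ℝ in 𝓝[>] 0, ε ^ 2 < q s :=
          ((continuous_pow 2).continuousAt.eventually_lt (continuousAt_const (y := q s))
            (by simpa using hs')).filter_mono nhdsWithin_le_nhds
        refine tendsto_const_nhds.congr' ?_
        filter_upwards [hε] with ε hε
        rw [indicator_of_mem (by exact hε)]
  refine ((Complex.continuous_ofReal.tendsto _).comp hlim |>.mul_const Complex.I).congr' ?_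
  filter_upwards [self_mem_nhdsWithin] with ε hε
  have hε2 : 0 < ε ^ 2 := pow_pos hε 2
  have h0 := integral_truncated_logDeriv_eq_zero (A := A) (B := B) hε2 h.hasDerivAt_normSq hq'c
    (by simp only [hA, hc])
  have hi := intervalIntegrable_truncated_logDeriv hε2 hqc hq'c A B
  -- Since `q' = 2rc`, the real part is `q' / (2q)`, whose truncated integral is zero by `h0`.
  have hpt : ∀ s, {s | ε ^ 2 < q s}.indicator
      (fun s => ((r s * c s / (a s ^ 2 + c s ^ 2) : ℝ) : ℂ) + ((f s : ℝ) : ℂ) * Complex.I) s =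
      (1 / 2 : ℂ) * (({s | ε ^ 2 < q s}.indicator (fun s => 2 * (r s * c s) / q s) s : ℝ) : ℂ) +
        (({s | ε ^ 2 < q s}.indicator f s : ℝ) : ℂ) * Complex.I := fun s => by
    by_cases hs : s ∈ {s | ε ^ 2 < q s}
    · simp only [indicator_of_mem hs]
      simp only [hq]
      push_cast
      ring
    · simp [indicator_of_notMem hs]
  simp only [Function.comp_apply]
  have hofReal : ∀ {g : ℝ → ℝ}, IntervalIntegrable g volume A B →
      IntervalIntegrable (fun s => ((g s : ℝ) : ℂ)) volume A B := fun hg =>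
    ⟨hg.1.ofReal, hg.2.ofReal⟩
  rw [intervalIntegral.integral_congr fun s _ => hpt s,
    intervalIntegral.integral_add ((hofReal hi).const_mul _) ((hofReal (hfε ε)).mul_const _),
    intervalIntegral.integral_const_mul, intervalIntegral.integral_mul_const,
    intervalIntegral.integral_ofReal, intervalIntegral.integral_ofReal, h0]
  simp

/-- Over a period, the evolute turns by `2π - πn`, where `n` is the number of zeros of `a`. -/
lemma integral_period (h : EvoluteSystem θ κ a c r) {L : ℝ} (hL : 0 < L)
    (hθ : ∀ s, θ (s + L) = θ s + 2 * Real.pi) (ha : Function.Periodic a L)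
    (hc : Function.Periodic c L) (hr : Function.Periodic r L) {z : ℝ} (hz : a z = 0) :
    ∫ s in (0 : ℝ)..L, r s * a s / (a s ^ 2 + c s ^ 2) =
      2 * Real.pi - Real.pi * {s ∈ Ico 0 L | a s = 0}.ncard := by
  have hper : Function.Periodic (fun s => r s * a s / (a s ^ 2 + c s ^ 2)) L := fun s => by
    simp only [ha s, hc s, hr s]
  have hP : Function.Periodic (fun s => a s = 0) L := fun s => by simp only [ha s]
  have hκi := h.curv_cont.intervalIntegrable (μ := volume) z (z + L)
  have hfi : IntervalIntegrable (fun s => r s * a s / (a s ^ 2 + c s ^ 2)) volume z (z + L) :=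
    (h.locallyIntegrable.integrableOn_isCompact isCompact_uIcc).intervalIntegrable
  -- `integral_eq` needs zeros of `a` at both ends, so the period starts at `z`; periodicity then
  -- moves it back to `0`.
  have h1 := h.integral_eq (lt_add_of_pos_right z hL) hz (by rw [ha, hz])
  rw [intervalIntegral.integral_sub hfi hκi,
    intervalIntegral.integral_eq_sub_of_hasDerivAt (fun s _ => h.angle s) hκi, hθ,
    hper.intervalIntegral_add_eq z 0, ncard_sep_Ico_periodic hL hP z 0] at h1
  simp only [zero_add] at h1
  linarith

end EvoluteSystem

end PlaneEquilibria

/-! ### Counting the equilibria. -/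

open PlaneEquilibria

theorem mainTheorem1 (K : Set ℂ) (hK : IsCompact K) (L : ℝ) (γ : ℝ → ℂ)
    (hγ : PlaneEquilibria.IsStronglyConvex 3 K L γ)
    (hstat : {s ∈ Set.Ico 0 L | deriv (PlaneEquilibria.curvature γ) s = 0}.Finite)
    (O : ℂ) :
    ∃ m : ℝ,
      PlaneEquilibria.HasWindingNumber (PlaneEquilibria.evolute γ) L O m ∧
      (∃ k : ℤ, m = (k : ℝ) / 2) ∧
      m ≤ 0 ∧
      (PlaneEquilibria.horizontalEquilibria K O).Finite ∧
      ((PlaneEquilibria.horizontalEquilibria K O).ncard : ℝ) = 2 - 2 * m ∧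
      (PlaneEquilibria.equilibriumAngles K O).Finite ∧
      ((PlaneEquilibria.equilibriumAngles K O).ncard : ℝ) = 2 - 2 * m := by
  have hL := hγ.param.length_pos
  obtain ⟨θ, hθ, hu⟩ := hγ.exists_normalAngle hK
  have hsys := hγ.evoluteSystem hK hstat O hθ
  set a : ℝ → ℝ := fun s => inner ℝ (deriv γ s) (γ s - O) with ha
  set c : ℝ → ℝ := fun s => inner ℝ (Complex.I * deriv γ s) (γ s - O) + (curvature γ s)⁻¹ with hc
  set r : ℝ → ℝ := fun s => -deriv (curvature γ) s / curvature γ s ^ 2 with hr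
  have hγp := hγ.param.periodic
  have hTp := Periodic.deriv hγp
  have hκp := hγ.periodic_curvature
  have hap : Function.Periodic a L := fun s => by simp only [ha, hγp s, hTp s]
  have hcp : Function.Periodic c L := fun s => by simp only [hc, hγp s, hTp s, hκp s]
  have hrp : Function.Periodic r L := fun s => by
    simp only [hr, hκp s, (Periodic.deriv hκp) s]
  have hP : Function.Periodic (fun s => a s = 0) L := fun s => by simp only [hap s]
  have hθL := hγ.normalAngle_add_length hK hθ hu
  have hfin : ∀ t, {s ∈ Ico t (t + L) | a s = 0}.Finite := fun t =>
    (hsys.finite_zeros t (t + L)).subset fun s hs => ⟨Ico_subset_Icc_self hs.1, hs.2⟩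
  -- the squared distance from `O` has derivative `2 a`
  have hD : ∀ s, HasDerivAt (fun s => ‖γ s - O‖ ^ 2) (2 * a s) s := fun s =>
    ((hγ.hasDerivAt s).sub_const O).norm_sq.congr_deriv (by rw [real_inner_comm])
  have hDc : Continuous fun s => ‖γ s - O‖ ^ 2 :=
    continuous_iff_continuousAt.2 fun s => (hD s).continuousAt
  have hrolle : ∀ t, ∃ z ∈ Ioo t (t + L), a z = 0 := fun t => by
    obtain ⟨z, hz, hz0⟩ := exists_hasDerivAt_eq_zero (lt_add_of_pos_right t hL)
      hDc.continuousOn (by simp only [hγp t]) fun s _ => hD s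
    exact ⟨z, hz, by linarith⟩
  obtain ⟨z, -, hz⟩ := hrolle 0
  obtain ⟨w, hw, hw0⟩ := hrolle z
  set n := {s ∈ Ico 0 L | a s = 0}.ncard with hn
  have hnt : ∀ t, {s ∈ Ico t (t + L) | a s = 0}.ncard = n := fun t => by
    rw [ncard_sep_Ico_periodic hL hP t 0, zero_add]
  -- Rolle's theorem on the period starting at the zero `z` yields a second zero `w` strictly inside
  -- it.
  have hn2 : 2 ≤ n := by
    rw [← hnt z, ← ncard_pair hw.1.ne]
    refine ncard_le_ncard ?_ (hfin z)
    rintro s (rfl | rfl)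
    · exact ⟨left_mem_Ico.2 (lt_add_of_pos_right s hL), hz⟩
    · exact ⟨Ioo_subset_Ico_self hw, hw0⟩
  have hn2' : (2 : ℝ) ≤ n := by exact_mod_cast hn2
  have hequil : ∀ s, HasDerivAt (supportFun K O) 0 (θ s) ↔ a s = 0 := fun s => by
    have h1 := hγ.hasDerivAt_supportFun hK O hθ hu s
    exact ⟨fun h2 => h1.unique h2, fun h2 => by rwa [← h2]⟩
  have hsurj := hγ.normalAngle_surjective hK hθ hu
  have hmono := hsys.strictMono_angle
  have hHE : horizontalEquilibria K O = γ '' {s ∈ Ico 0 L | a s = 0} := by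
    ext x
    constructor
    · rintro ⟨-, φ, hφ, rfl⟩
      obtain ⟨s, rfl⟩ := hsurj φ
      obtain ⟨h1, -⟩ := toIcoMod_image_sep hL hP s 0
      rw [zero_add] at h1
      rw [← h1, hγ.boundaryPoint_normalAngle hK O hθ hu]
      refine ⟨_, mem_image_of_mem _
        ⟨left_mem_Ico.2 (lt_add_of_pos_right s hL), (hequil s).1 hφ⟩, ?_⟩
      exact hγp.sub_zsmul_eq (toIcoDiv hL 0 s)
    · rintro ⟨s, ⟨-, hs⟩, rfl⟩
      exact ⟨hγ.mem_frontier s, θ s, (hequil s).2 hs,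
        (hγ.boundaryPoint_normalAngle hK O hθ hu s).symm⟩
  -- Starting the period where `θ` vanishes makes `θ` map it exactly onto `[0, 2π)`.
  obtain ⟨t, ht⟩ := hsurj 0
  have hEA : equilibriumAngles K O = θ '' {s ∈ Ico t (t + L) | a s = 0} := by
    have hIco : ∀ s, θ s ∈ Ico 0 (2 * Real.pi) ↔ s ∈ Ico t (t + L) := fun s => by
      rw [mem_Ico, mem_Ico, ← hmono.le_iff_le (a := t), ← hmono.lt_iff_lt (b := t + L), hθL, ht,
        zero_add]
    ext φ
    obtain ⟨s, rfl⟩ := hsurj φ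
    rw [hmono.injective.mem_set_image]
    exact and_congr (hIco s) (hequil s)
  have hfin0 : {s ∈ Ico 0 L | a s = 0}.Finite := by simpa using hfin 0
  -- The angular integral `2π - πn` divided by `2π`; `n ≥ 2` makes it nonpositive.
  refine ⟨1 - n / 2, ?_, ⟨2 - n, by push_cast; ring⟩, by linarith, ?_, ?_, ?_, ?_⟩
  · have hlim := hsys.tendsto_integral (A := 0) (B := L) (by rw [← hap 0, zero_add])
      (by rw [← hcp 0, zero_add])
    rw [hsys.integral_period hL hθL hap hcp hrp hz] at hlim
    have hval : ((1 - n / 2 : ℝ) : ℂ) = (2 * Real.pi * Complex.I)⁻¹ *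
        (((2 * Real.pi - Real.pi * n : ℝ) : ℂ) * Complex.I) := by
      have := Real.pi_ne_zero
      push_cast
      field_simp
    rw [HasWindingNumber, hval]
    refine (hlim.const_mul _).congr' ?_
    filter_upwards [self_mem_nhdsWithin] with ε hε
    have hset : {s | ε < ‖evolute γ s - O‖} = {s | ε ^ 2 < a s ^ 2 + c s ^ 2} := by
      ext s
      rw [mem_ofPred_eq, mem_ofPred_eq, ← hγ.norm_evolute_sub_sq hK O s,
        pow_lt_pow_iff_left₀ (le_of_lt hε) (norm_nonneg _) two_ne_zero]
    have hmeas : MeasurableSet {s | ε ^ 2 < a s ^ 2 + c s ^ 2} :=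
      measurableSet_lt measurable_const
        ((hsys.continuous_tangential.pow 2).add (hsys.continuous_normal.pow 2)).measurable
    congr 1
    rw [show {s ∈ Ioc 0 L | ε < ‖evolute γ s - O‖} =
      Ioc 0 L ∩ {s | ε ^ 2 < a s ^ 2 + c s ^ 2} by rw [← hset]; rfl,
      ← setIntegral_indicator hmeas, intervalIntegral.integral_of_le hL.le]
    congr 1
    ext s
    congr 1
    ext s
    exact (hγ.evolute_logDeriv hK O s rfl rfl rfl).symm
  · rw [hHE]; exact hfin0.image γ
  · rw [hHE, (hγ.param.injOn.mono (sep_subset _ _)).ncard_image]; ring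
  · rw [hEA]; exact (hfin t).image θ
  · rw [hEA, ncard_image_of_injective _ hmono.injective, hnt]; ring
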